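/- A triangulated disk is a finite simplicial complex, every maximal simplex of which is a triangle, together with a homeomorphism of its underlying space onto the closed unit disk; its boundary is the part of the complex that is sent to the unit circle. It is a triangulated isometric filling of the cycle graph of length $n$ if its boundary is a cycle with $n$ vertices and $n$ edges, and if every path in its $1$-skeleton between two boundary vertices $u$ and $v$ has at least as many edges as a shortest path from $u$ to $v$ in the boundary cycle. **Lemma.** For every integer $n \ge 3$, the cycle graph of length $n$ has a triangulated isometric filling. -/

import Mathlib

/-- A (finite) triangulation of the closed disk: a finite geometric simplicial complex in some
`ℝ^d`, all of whose maximal faces are triangles, together with a homeomorphism from its underlying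
space onto the closed unit disk of the Euclidean plane. -/
structure DiskTriangulation (d : ℕ) where
  complex : Geometry.SimplicialComplex ℝ (EuclideanSpace ℝ (Fin d))
  finite_faces : complex.faces.Finite
  triangular : ∀ s ∈ complex.faces, ∃ t ∈ complex.faces, s ⊆ t ∧ t.card = 3
  homeo : complex.space ≃ₜ Metric.closedBall (0 : EuclideanSpace ℝ (Fin 2)) 1

namespace DiskTriangulation

/-- The boundary of the triangulated disk: the points of the underlying space that the
homeomorphism sends to the unit circle. -/
def boundary {d : ℕ} (T : DiskTriangulation d) : Set (EuclideanSpace ℝ (Fin d)) :=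
  {x | ∃ hx : x ∈ T.complex.space,
    (T.homeo ⟨x, hx⟩ : EuclideanSpace ℝ (Fin 2)) ∈
      Metric.sphere (0 : EuclideanSpace ℝ (Fin 2)) 1}

open scoped Classical in
/-- The graph of vertices and edges of the triangulation. -/
def oneSkeleton {d : ℕ} (T : DiskTriangulation d) : SimpleGraph T.complex.vertices where
  Adj u v := u ≠ v ∧
    ({(u : EuclideanSpace ℝ (Fin d)), (v : EuclideanSpace ℝ (Fin d))} :
      Finset (EuclideanSpace ℝ (Fin d))) ∈ T.complex.faces
  symm := ⟨fun u v h => ⟨h.1.symm, by rw [Finset.pair_comm]; exact h.2⟩⟩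
  loopless := ⟨fun _ h => h.1 rfl⟩

/-- The vertices of the triangulation that lie on the boundary of the disk. -/
abbrev BoundaryVertex {d : ℕ} (T : DiskTriangulation d) : Type :=
  {v : T.complex.vertices // (v : EuclideanSpace ℝ (Fin d)) ∈ T.boundary}

/-- The boundary of the triangulated disk as a graph: its vertices are the vertices on the
boundary, its edges are the edges of the triangulation that are contained in the boundary. -/
def boundaryGraph {d : ℕ} (T : DiskTriangulation d) : SimpleGraph T.BoundaryVertex where
  Adj u v := T.oneSkeleton.Adj u.1 v.1 ∧
    segment ℝ (u.1 : EuclideanSpace ℝ (Fin d)) (v.1 : EuclideanSpace ℝ (Fin d)) ⊆ T.boundary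
  symm := ⟨fun _ _ h => ⟨h.1.symm, by rw [segment_symm]; exact h.2⟩⟩
  loopless := ⟨fun _ h => T.oneSkeleton.loopless.irrefl _ h.1⟩

/-- The triangulated disk `T` is an isometric filling of the cycle graph of length `n`: its
boundary is a cycle of length `n`, and every path in the 1-skeleton that connects two boundary
vertices has at least as many edges as a shortest path in the boundary between them. -/
structure IsIsometricFilling {d : ℕ} (T : DiskTriangulation d) (n : ℕ) : Prop where
  boundary_cycle : Nonempty (T.boundaryGraph ≃g SimpleGraph.cycleGraph n)
  isometric : ∀ (u v : T.BoundaryVertex) (p : T.oneSkeleton.Walk u.1 v.1),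
    T.boundaryGraph.dist u v ≤ p.length

end DiskTriangulation

/-! Take the cone over the boundary cycle and make it deep enough that a shortcut through the
interior cannot pay off. In `ℝ^n`, consecutive coordinate axes span `n` flat sectors around the
origin. Each sector is cut at the integer heights (sums of coordinates), and each layer above the
first is split by a diagonal into two triangles. Up to height `m` this is a disk whose boundary is
the `n`-cycle at height `m`.

For a boundary vertex `v`, give the vertex at height `q` on axis `i` the value `min q d`, where `d`
is the boundary distance from the end of that axis to `v`. Along an edge both `q` and `d` change by
at most 1, hence so does the minimum (`potential_le_of_adj`). If `m ≥ n`, the minimum at a boundary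
vertex is `d` itself, so a walk from `u` to `v` has at least `d(u, v)` edges.

The geometric work is that faces meet properly (`inter_subset`, by separating hyperplanes), that the
triangles fill the cone (`space_complex`), and that polar coordinates give a homeomorphism with the
disk (`diskHomeo`). -/

/-! ### Convex hulls, supporting hyperplanes and affine independence -/

open scoped Classical in
theorem mem_convexHull_inter_hyperplane {E : Type*} [AddCommGroup E] [Module ℝ E] {s : Finset E}
    (g : E →ₗ[ℝ] ℝ) {c : ℝ} (hs : ∀ y ∈ s, g y ≤ c) {x : E}
    (hx : x ∈ convexHull ℝ (s : Set E)) (hgx : g x = c) :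
    x ∈ convexHull ℝ ((s : Set E) ∩ {y | g y = c}) := by
  obtain ⟨w, hw0, hw1, rfl⟩ := Finset.mem_convexHull.1 hx
  rw [Finset.centerMass_eq_of_sum_1 _ _ hw1] at hgx
  -- A sum of nonnegative terms that vanishes: only vertices on the hyperplane can carry weight.
  have hsum : ∑ y ∈ s, w y * (c - g y) = 0 := by
    simp only [map_sum, map_smul, id, smul_eq_mul] at hgx
    simp only [mul_sub, Finset.sum_sub_distrib, ← Finset.sum_mul, hw1, hgx]
    ring
  have hzero := (Finset.sum_eq_zero_iff_of_nonneg
    (fun y hy => mul_nonneg (hw0 y hy) (sub_nonneg.2 (hs y hy)))).1 hsum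
  rw [← Finset.centerMass_filter_ne_zero]
  refine Finset.centerMass_mem_convexHull _ (fun y hy => hw0 y (Finset.mem_filter.1 hy).1) ?_ ?_
  · rw [Finset.sum_filter_ne_zero, hw1]
    exact one_pos
  · intro y hy
    obtain ⟨hys, hy0⟩ := Finset.mem_filter.1 hy
    refine ⟨hys, ?_⟩
    have := (mul_eq_zero.1 (hzero y hys)).resolve_left hy0
    simp only [id, Set.mem_ofPred_eq]
    linarith

theorem le_of_mem_convexHull {E : Type*} [AddCommGroup E] [Module ℝ E] {s : Set E}
    (g : E →ₗ[ℝ] ℝ) {c : ℝ} (hs : ∀ y ∈ s, g y ≤ c) {x : E}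
    (hx : x ∈ convexHull ℝ s) : g x ≤ c :=
  convexHull_min (t := {y | g y ≤ c}) hs (convex_halfSpace_le g.isLinear c) hx

theorem ge_of_mem_convexHull {E : Type*} [AddCommGroup E] [Module ℝ E] {s : Set E}
    (g : E →ₗ[ℝ] ℝ) {c : ℝ} (hs : ∀ y ∈ s, c ≤ g y) {x : E}
    (hx : x ∈ convexHull ℝ s) : c ≤ g x :=
  convexHull_min (t := {y | c ≤ g y}) hs (convex_halfSpace_ge g.isLinear c) hx

/-- A common point lies on the hyperplane `g = c`, hence in the face that `s` has there. That face
and `s'` both consist of vertices of the simplex `t`, where hulls of vertex sets meet in the hull of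
the common vertices. -/
theorem convexHull_inter_subset_of_separated {E : Type*} [AddCommGroup E] [Module ℝ E]
    {s s' t : Finset E} (g : E →ₗ[ℝ] ℝ) {c : ℝ} (hs : ∀ y ∈ s, g y ≤ c) (hs' : ∀ y ∈ s', c ≤ g y)
    (hst : ∀ y ∈ s, g y = c → y ∈ t) (hs't : s' ⊆ t)
    (ht : AffineIndependent ℝ ((↑) : t → E)) :
    convexHull ℝ (s : Set E) ∩ convexHull ℝ (s' : Set E) ⊆ convexHull ℝ (s ∩ s' : Set E) := by
  classical
  rintro x ⟨hx, hx'⟩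
  have hgx : g x = c := le_antisymm (le_of_mem_convexHull g hs hx) (ge_of_mem_convexHull g hs' hx')
  have hx1 := mem_convexHull_inter_hyperplane g hs hx hgx
  have heq : (s : Set E) ∩ {y | g y = c} = ((s.filter fun y => g y = c : Finset E) : Set E) := by
    ext; simp
  rw [heq] at hx1
  have hsub : (s.filter fun y => g y = c) ⊆ t := fun y hy =>
    hst y (Finset.mem_filter.1 hy).1 (Finset.mem_filter.1 hy).2
  have hx2 := (ht.convexHull_inter hsub hs't).symm.subset ⟨hx1, hx'⟩
  refine convexHull_mono ?_ hx2
  intro y hy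
  exact ⟨(Finset.mem_filter.1 hy.1).1, hy.2⟩

theorem affineIndependent_triple {E : Type*} [AddCommGroup E] [Module ℝ E] {t : Finset E}
    {p q r : E} (ht : ∀ x, x ∈ t ↔ x = p ∨ x = q ∨ x = r)
    (h : ∀ a b c : ℝ, a + b + c = 0 → a • p + b • q + c • r = 0 → a = 0 ∧ b = 0 ∧ c = 0) :
    AffineIndependent ℝ ((↑) : t → E) := by
  have key : AffineIndependent ℝ ![p, q, r] := by
    rw [affineIndependent_iff]
    intro s w hw hw0 k hk
    have hw' : ∑ k, (if k ∈ s then w k else 0) = 0 := by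
      rw [Finset.sum_ite_mem, Finset.univ_inter, hw]
    have hw0' : ∑ k, (if k ∈ s then w k else 0) • ![p, q, r] k = 0 := by
      simp only [ite_smul, zero_smul]
      rw [Finset.sum_ite_mem, Finset.univ_inter, hw0]
    rw [Fin.sum_univ_three] at hw' hw0'
    obtain ⟨h0, h1, h2⟩ := h _ _ _ hw' hw0'
    fin_cases k
    · exact (if_pos hk).symm.trans h0
    · exact (if_pos hk).symm.trans h1
    · exact (if_pos hk).symm.trans h2
  have hrange : Set.range ![p, q, r] = (t : Set E) := by
    ext x
    simp [ht, eq_comm, or_comm, or_left_comm]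
  have := key.range
  rw [hrange] at this
  exact this

/-! ### Triangles of the sectors -/

namespace ConeStrip

variable {n : ℕ}

/-- The point at height `h` on the `i`-th coordinate axis. -/
noncomputable def ray (i : Fin n) (h : ℕ) : EuclideanSpace ℝ (Fin n) :=
  EuclideanSpace.single i (h : ℝ)

theorem ray_apply (i c : Fin n) (h : ℕ) : ray i h c = if c = i then (h : ℝ) else 0 := by
  simp [ray]

theorem ray_zero (i : Fin n) : ray i 0 = 0 := by
  ext c; simp [ray_apply]

theorem sum_ray (i : Fin n) (h : ℕ) : ∑ c, ray i h c = h := by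
  simp [ray_apply]

theorem ray_injective {i j : Fin n} {p q : ℕ} (hp : 1 ≤ p) (h : ray i p = ray j q) :
    i = j ∧ p = q := by
  have h1 : p = q := by
    have := congrArg (fun x : EuclideanSpace ℝ (Fin n) => ∑ c, x c) h
    simp only [sum_ray] at this
    exact_mod_cast this
  have h2 := congrArg (fun x : EuclideanSpace ℝ (Fin n) => x i) h
  simp only [ray_apply, if_true] at h2
  by_cases hij : i = j
  · exact ⟨hij, h1⟩
  · rw [if_neg hij, Nat.cast_eq_zero] at h2
    omega

variable [NeZero n]

open scoped Classical in
/-- The triangle of the `i`-th sector with two vertices at height `h` and one at height `h + 1`. -/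
noncomputable def lower (i : Fin n) (h : ℕ) : Finset (EuclideanSpace ℝ (Fin n)) :=
  {ray i h, ray (i + 1) h, ray i (h + 1)}

open scoped Classical in
/-- The triangle of the `i`-th sector with one vertex at height `h` and two at height `h + 1`. -/
noncomputable def upper (i : Fin n) (h : ℕ) : Finset (EuclideanSpace ℝ (Fin n)) :=
  {ray (i + 1) h, ray i (h + 1), ray (i + 1) (h + 1)}

theorem mem_lower {i : Fin n} {h : ℕ} {x : EuclideanSpace ℝ (Fin n)} :
    x ∈ lower i h ↔ x = ray i h ∨ x = ray (i + 1) h ∨ x = ray i (h + 1) := by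
  simp [lower]

theorem mem_upper {i : Fin n} {h : ℕ} {x : EuclideanSpace ℝ (Fin n)} :
    x ∈ upper i h ↔ x = ray (i + 1) h ∨ x = ray i (h + 1) ∨ x = ray (i + 1) (h + 1) := by
  simp [upper]

theorem one_ne_zero_fin (hn : 3 ≤ n) : (1 : Fin n) ≠ 0 := by
  intro h
  have := congrArg Fin.val h
  rw [Fin.val_one', Fin.val_zero, Nat.mod_eq_of_lt (by omega)] at this
  omega

theorem two_ne_zero_fin (hn : 3 ≤ n) : (1 + 1 : Fin n) ≠ 0 := by
  intro h
  have := congrArg Fin.val h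
  rw [Fin.val_add, Fin.val_one', Fin.val_zero, Nat.mod_eq_of_lt (a := 1) (by omega),
    Nat.mod_eq_of_lt (by omega)] at this
  omega

theorem add_one_ne (hn : 3 ≤ n) (i : Fin n) : i + 1 ≠ i := by
  simpa using one_ne_zero_fin hn

theorem add_one_add_one_ne (hn : 3 ≤ n) (i : Fin n) : i + 1 + 1 ≠ i := by
  rw [add_assoc]
  simpa using two_ne_zero_fin hn

/-- At `h = 0` two of the three vertices coincide with the origin, so `1 ≤ h` is essential; the
innermost layer of a sector is the single triangle `upper i 0`. -/
theorem affineIndependent_lower (hn : 3 ≤ n) (i : Fin n) {h : ℕ} (hh : 1 ≤ h) :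
    AffineIndependent ℝ ((↑) : lower i h → EuclideanSpace ℝ (Fin n)) := by
  refine affineIndependent_triple (fun _ => mem_lower) fun a b c hw hw0 => ?_
  have hi := congrArg (fun x : EuclideanSpace ℝ (Fin n) => x i) hw0
  have hi' := congrArg (fun x : EuclideanSpace ℝ (Fin n) => x (i + 1)) hw0
  have h1 := add_one_ne hn i
  simp [ray_apply, h1, h1.symm] at hi hi'
  have hh' : h ≠ 0 := by omega
  have e1 : b = 0 := by tauto
  have e2 : c = 0 := by linear_combination hi - (h : ℝ) * hw + h * e1
  exact ⟨by linarith, e1, e2⟩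

theorem affineIndependent_upper (hn : 3 ≤ n) (i : Fin n) (h : ℕ) :
    AffineIndependent ℝ ((↑) : upper i h → EuclideanSpace ℝ (Fin n)) := by
  refine affineIndependent_triple (fun _ => mem_upper) fun a b c hw hw0 => ?_
  have hi := congrArg (fun x : EuclideanSpace ℝ (Fin n) => x i) hw0
  have hi' := congrArg (fun x : EuclideanSpace ℝ (Fin n) => x (i + 1)) hw0
  have h1 := add_one_ne hn i
  simp [ray_apply, h1, h1.symm] at hi hi'
  have hh' : (h : ℝ) + 1 ≠ 0 := by positivity
  have e1 : b = 0 := by tauto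
  have e2 : c = 0 := by linear_combination hi' - (h : ℝ) * hw + h * e1
  exact ⟨by linarith, e1, e2⟩

theorem card_upper (hn : 3 ≤ n) (i : Fin n) (h : ℕ) : (upper i h).card = 3 := by
  have h1 := add_one_ne hn i
  have h2 : (h : ℝ) + 1 ≠ 0 := by positivity
  refine Finset.card_eq_three.2 ⟨_, _, _, ?_, ?_, ?_, rfl⟩
  · intro e
    have := congrArg (fun x : EuclideanSpace ℝ (Fin n) => x i) e
    simp [ray_apply, h1.symm, h2.symm] at this
  · intro e
    have := congrArg (fun x : EuclideanSpace ℝ (Fin n) => x (i + 1)) e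
    simp [ray_apply] at this
  · intro e
    have := congrArg (fun x : EuclideanSpace ℝ (Fin n) => x i) e
    simp [ray_apply, h1.symm, h2] at this

theorem card_lower (hn : 3 ≤ n) (i : Fin n) {h : ℕ} (hh : 1 ≤ h) : (lower i h).card = 3 := by
  have h1 := add_one_ne hn i
  have h2 : (h : ℝ) + 1 ≠ 0 := by positivity
  have h3 : h ≠ 0 := by omega
  refine Finset.card_eq_three.2 ⟨_, _, _, ?_, ?_, ?_, rfl⟩
  · intro e
    have := congrArg (fun x : EuclideanSpace ℝ (Fin n) => x i) e
    simp [ray_apply, h1.symm, h3] at this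
  · intro e
    have := congrArg (fun x : EuclideanSpace ℝ (Fin n) => x i) e
    simp [ray_apply] at this
  · intro e
    have := congrArg (fun x : EuclideanSpace ℝ (Fin n) => x i) e
    simp [ray_apply, h1.symm, h2.symm] at this

/-- The triangles of the `i`-th sector. -/
def IsTriangle (i : Fin n) (t : Finset (EuclideanSpace ℝ (Fin n))) : Prop :=
  ∃ h, t = upper i h ∨ 1 ≤ h ∧ t = lower i h

theorem IsTriangle.affineIndependent (hn : 3 ≤ n) {i : Fin n}
    {t : Finset (EuclideanSpace ℝ (Fin n))} (ht : IsTriangle i t) :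
    AffineIndependent ℝ ((↑) : t → EuclideanSpace ℝ (Fin n)) := by
  obtain ⟨h, rfl | ⟨hh, rfl⟩⟩ := ht
  · exact affineIndependent_upper hn i h
  · exact affineIndependent_lower hn i hh

/-! ### Faces meet in common faces -/

/-- The linear functional with weight `a` on the `i`-th coordinate and `b` on the next one. -/
noncomputable def sectorForm (i : Fin n) (a b : ℝ) : EuclideanSpace ℝ (Fin n) →ₗ[ℝ] ℝ :=
  ((a • EuclideanSpace.proj i + b • EuclideanSpace.proj (i + 1) :
    EuclideanSpace ℝ (Fin n) →L[ℝ] ℝ) : EuclideanSpace ℝ (Fin n) →ₗ[ℝ] ℝ)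

theorem sectorForm_ray_left (hn : 3 ≤ n) (i : Fin n) (a b : ℝ) (h : ℕ) :
    sectorForm i a b (ray i h) = a * h := by
  simp [sectorForm, ray_apply, add_one_ne hn i]

theorem sectorForm_ray_right (hn : 3 ≤ n) (i : Fin n) (a b : ℝ) (h : ℕ) :
    sectorForm i a b (ray (i + 1) h) = b * h := by
  simp [sectorForm, ray_apply, (add_one_ne hn i).symm]

/-- Within a sector the triangles are ordered outward from the apex: `upper 0`, `lower 1`, `upper
1`, `lower 2`, and so on. The inner edge of `lower i h'` lies on the line of height `h'`, which
separates it from all earlier triangles. -/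
theorem inter_subset_of_before_lower (hn : 3 ≤ n) {i : Fin n}
    {s s' t : Finset (EuclideanSpace ℝ (Fin n))} {h h' : ℕ} (hh' : 1 ≤ h')
    (ht : t = upper i h ∨ t = lower i h) (hlt : h < h') (hs : s ⊆ t) (hs' : s' ⊆ lower i h') :
    convexHull ℝ (s : Set _) ∩ convexHull ℝ (s' : Set _) ⊆
      convexHull ℝ (s ∩ s' : Set (EuclideanSpace ℝ (Fin n))) := by
  have hc : ((h : ℝ) + 1) ≤ h' := by exact_mod_cast hlt
  have key : ∀ y ∈ t, sectorForm i 1 1 y ≤ h' ∧ (sectorForm i 1 1 y = h' → y ∈ lower i h') := by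
    rcases ht with rfl | rfl
    · intro y hy
      rcases mem_upper.1 hy with rfl | rfl | rfl
      · rw [sectorForm_ray_right hn]
        exact ⟨by linarith, fun e => by linarith⟩
      · rw [sectorForm_ray_left hn]
        refine ⟨by push_cast; linarith, fun e => mem_lower.2 (.inl ?_)⟩
        congr 1; exact_mod_cast (one_mul _).symm.trans e
      · rw [sectorForm_ray_right hn]
        refine ⟨by push_cast; linarith, fun e => mem_lower.2 (.inr (.inl ?_))⟩
        congr 1; exact_mod_cast (one_mul _).symm.trans e
    · intro y hy
      rcases mem_lower.1 hy with rfl | rfl | rfl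
      · rw [sectorForm_ray_left hn]
        exact ⟨by linarith, fun e => by linarith⟩
      · rw [sectorForm_ray_right hn]
        exact ⟨by linarith, fun e => by linarith⟩
      · rw [sectorForm_ray_left hn]
        refine ⟨by push_cast; linarith, fun e => mem_lower.2 (.inl ?_)⟩
        congr 1; exact_mod_cast (one_mul _).symm.trans e
  refine convexHull_inter_subset_of_separated (t := lower i h') (sectorForm i 1 1) (c := h')
    (fun y hy => (key y (hs hy)).1) ?_ (fun y hy => (key y (hs hy)).2) hs'
    (affineIndependent_lower hn i hh')
  intro y hy
  rcases mem_lower.1 (hs' hy) with rfl | rfl | rfl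
  · rw [sectorForm_ray_left hn]; linarith
  · rw [sectorForm_ray_right hn]; linarith
  · rw [sectorForm_ray_left hn]; push_cast; linarith

/-- The separating line now contains the diagonal from height `h'` on axis `i + 1` to height `h' +
1` on axis `i`; the weights `h'` and `h' + 1` give both ends the value `h' * (h' + 1)`. -/
theorem inter_subset_of_before_upper (hn : 3 ≤ n) {i : Fin n}
    {s s' t : Finset (EuclideanSpace ℝ (Fin n))} {h h' : ℕ} (hh' : 1 ≤ h')
    (ht : t = upper i h ∧ h < h' ∨ t = lower i h ∧ h ≤ h') (hs : s ⊆ t) (hs' : s' ⊆ upper i h') :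
    convexHull ℝ (s : Set _) ∩ convexHull ℝ (s' : Set _) ⊆
      convexHull ℝ (s ∩ s' : Set (EuclideanSpace ℝ (Fin n))) := by
  have h0 : (0 : ℝ) < h' := by exact_mod_cast hh'
  have key : ∀ y ∈ t, sectorForm i h' (h' + 1) y ≤ h' * (h' + 1) ∧
      (sectorForm i h' (h' + 1) y = h' * (h' + 1) → y ∈ upper i h') := by
    have left : ∀ q : ℕ, q ≤ h' + 1 → sectorForm i h' (h' + 1) (ray i q) ≤ h' * (h' + 1) ∧
        (sectorForm i h' (h' + 1) (ray i q) = h' * (h' + 1) → ray i q ∈ upper i h') := by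
      intro q hq
      have hq' : (q : ℝ) ≤ h' + 1 := by exact_mod_cast hq
      rw [sectorForm_ray_left hn]
      refine ⟨mul_le_mul_of_nonneg_left hq' h0.le, fun e => mem_upper.2 (.inr (.inl ?_))⟩
      congr 1; exact_mod_cast mul_left_cancel₀ h0.ne' e
    have right : ∀ q : ℕ, q ≤ h' → sectorForm i h' (h' + 1) (ray (i + 1) q) ≤ h' * (h' + 1) ∧
        (sectorForm i h' (h' + 1) (ray (i + 1) q) = h' * (h' + 1) →
          ray (i + 1) q ∈ upper i h') := by
      intro q hq
      have hq' : (q : ℝ) ≤ h' := by exact_mod_cast hq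
      have h1 : (0 : ℝ) < h' + 1 := by positivity
      rw [sectorForm_ray_right hn, mul_comm (h' : ℝ)]
      refine ⟨mul_le_mul_of_nonneg_left hq' h1.le, fun e => mem_upper.2 (.inl ?_)⟩
      congr 1; exact_mod_cast mul_left_cancel₀ h1.ne' e
    rcases ht with ⟨rfl, hlt⟩ | ⟨rfl, hle⟩
    · intro y hy
      rcases mem_upper.1 hy with rfl | rfl | rfl
      · exact right _ hlt.le
      · exact left _ (by omega)
      · exact right _ (by omega)
    · intro y hy
      rcases mem_lower.1 hy with rfl | rfl | rfl
      · exact left _ (by omega)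
      · exact right _ hle
      · exact left _ (by omega)
  refine convexHull_inter_subset_of_separated (t := upper i h') (sectorForm i h' (h' + 1))
    (c := h' * (h' + 1)) (fun y hy => (key y (hs hy)).1) ?_ (fun y hy => (key y (hs hy)).2) hs'
    (affineIndependent_upper hn i h')
  intro y hy
  rcases mem_upper.1 (hs' hy) with rfl | rfl | rfl
  · rw [sectorForm_ray_right hn]; linarith
  · rw [sectorForm_ray_left hn]; push_cast; linarith
  · rw [sectorForm_ray_right hn]; push_cast; nlinarith

theorem convexHull_inter_subset_same {E : Type*} [AddCommGroup E] [Module ℝ E]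
    {s s' t : Finset E} (hs : s ⊆ t) (hs' : s' ⊆ t) (ht : AffineIndependent ℝ ((↑) : t → E)) :
    convexHull ℝ (s : Set E) ∩ convexHull ℝ (s' : Set E) ⊆ convexHull ℝ (s ∩ s' : Set E) :=
  (ht.convexHull_inter hs hs').symm.subset

/-- Distinct triangles of a sector are comparable in the outward order; at equal level, `lower`
precedes `upper`. -/
theorem inter_subset_same_sector (hn : 3 ≤ n) {i : Fin n}
    {s s' t t' : Finset (EuclideanSpace ℝ (Fin n))} (ht : IsTriangle i t) (ht' : IsTriangle i t')
    (hs : s ⊆ t) (hs' : s' ⊆ t') :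
    convexHull ℝ (s : Set _) ∩ convexHull ℝ (s' : Set _) ⊆
      convexHull ℝ (s ∩ s' : Set (EuclideanSpace ℝ (Fin n))) := by
  by_cases heq : t = t'
  · subst heq
    exact convexHull_inter_subset_same hs hs' (ht.affineIndependent hn)
  obtain ⟨h, ht⟩ := ht
  obtain ⟨h', ht'⟩ := ht'
  rcases ht with rfl | ⟨hh, rfl⟩ <;> rcases ht' with rfl | ⟨hh', rfl⟩
  · rcases lt_trichotomy h h' with hlt | rfl | hlt
    · exact inter_subset_of_before_upper hn (by omega) (.inl ⟨rfl, hlt⟩) hs hs'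
    · exact absurd rfl heq
    · rw [Set.inter_comm, Set.inter_comm (s : Set (EuclideanSpace ℝ (Fin n)))]
      exact inter_subset_of_before_upper hn (by omega) (.inl ⟨rfl, hlt⟩) hs' hs
  · rcases lt_or_ge h h' with hlt | hle
    · exact inter_subset_of_before_lower hn hh' (.inl rfl) hlt hs hs'
    · rw [Set.inter_comm, Set.inter_comm (s : Set (EuclideanSpace ℝ (Fin n)))]
      exact inter_subset_of_before_upper hn (by omega) (.inr ⟨rfl, hle⟩) hs' hs
  · rcases lt_or_ge h' h with hlt | hle
    · rw [Set.inter_comm, Set.inter_comm (s : Set (EuclideanSpace ℝ (Fin n)))]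
      exact inter_subset_of_before_lower hn hh (.inl rfl) hlt hs' hs
    · exact inter_subset_of_before_upper hn (by omega) (.inr ⟨rfl, hle⟩) hs hs'
  · rcases lt_trichotomy h h' with hlt | rfl | hlt
    · exact inter_subset_of_before_lower hn hh' (.inr rfl) hlt hs hs'
    · exact absurd rfl heq
    · rw [Set.inter_comm, Set.inter_comm (s : Set (EuclideanSpace ℝ (Fin n)))]
      exact inter_subset_of_before_lower hn hh (.inr rfl) hlt hs' hs

/-- The sum of the coordinates outside the `i`-th sector. -/
noncomputable def outsideForm (i : Fin n) : EuclideanSpace ℝ (Fin n) →ₗ[ℝ] ℝ :=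
  ((∑ c, EuclideanSpace.proj c - EuclideanSpace.proj i - EuclideanSpace.proj (i + 1) :
    EuclideanSpace ℝ (Fin n) →L[ℝ] ℝ) : EuclideanSpace ℝ (Fin n) →ₗ[ℝ] ℝ)

theorem outsideForm_ray (hn : 3 ≤ n) (i k : Fin n) (h : ℕ) :
    outsideForm i (ray k h) = if k = i ∨ k = i + 1 then 0 else (h : ℝ) := by
  have h1 := add_one_ne hn i
  by_cases h2 : k = i
  · subst h2
    simp [outsideForm, ray_apply, h1]
  · by_cases h3 : k = i + 1
    · subst h3
      simp [outsideForm, ray_apply, h1.symm]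
    · simp [outsideForm, ray_apply, h2, h3, Ne.symm h2, Ne.symm h3]

theorem IsTriangle.exists_eq_ray {i : Fin n} {t : Finset (EuclideanSpace ℝ (Fin n))}
    (ht : IsTriangle i t) {x : EuclideanSpace ℝ (Fin n)} (hx : x ∈ t) :
    ∃ k h, (k = i ∨ k = i + 1) ∧ x = ray k h := by
  obtain ⟨h, rfl | ⟨hh, rfl⟩⟩ := ht
  · rcases mem_upper.1 hx with rfl | rfl | rfl
    exacts [⟨_, _, .inr rfl, rfl⟩, ⟨_, _, .inl rfl, rfl⟩, ⟨_, _, .inr rfl, rfl⟩]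
  · rcases mem_lower.1 hx with rfl | rfl | rfl
    exacts [⟨_, _, .inl rfl, rfl⟩, ⟨_, _, .inr rfl, rfl⟩, ⟨_, _, .inl rfl, rfl⟩]

theorem zero_mem_upper_zero (i : Fin n) : (0 : EuclideanSpace ℝ (Fin n)) ∈ upper i 0 :=
  mem_upper.2 (.inl (ray_zero _).symm)

/-- Two sectors share an axis or only the apex. The vertices of a triangle on a shared axis have
consecutive heights, so one triangle of sector `i` contains them all. -/
theorem IsTriangle.exists_of_other_sector (hn : 3 ≤ n) {i j : Fin n} (hij : j ≠ i)
    {t : Finset (EuclideanSpace ℝ (Fin n))} (ht : IsTriangle j t) :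
    ∃ t', IsTriangle i t' ∧ ∀ x ∈ t, outsideForm i x = 0 → x ∈ t' := by
  have h1 := add_one_ne hn j
  have h2 := add_one_add_one_ne hn i
  have out : ∀ k q, k ≠ i → k ≠ i + 1 → outsideForm i (ray k q) = 0 → q = 0 := by
    intro k q hk hk' hq
    rw [outsideForm_ray hn, if_neg (by tauto)] at hq
    exact_mod_cast hq
  by_cases hj : j = i + 1
  · subst hj
    have out' := fun q => out (i + 1 + 1) q h2 h1
    obtain ⟨h, ht⟩ := ht
    -- The shared axis is `i + 1`, and `upper i h` contains its points at heights `h` and `h + 1`.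
    refine ⟨upper i h, ⟨h, .inl rfl⟩, ?_⟩
    rcases ht with rfl | ⟨hh, rfl⟩
    · intro x hx hx0
      rcases mem_upper.1 hx with rfl | rfl | rfl
      · obtain rfl := out' _ hx0
        rw [ray_zero]
        exact zero_mem_upper_zero i
      · exact mem_upper.2 (.inr (.inr rfl))
      · exact absurd (out' _ hx0) (by omega)
    · intro x hx hx0
      rcases mem_lower.1 hx with rfl | rfl | rfl
      · exact mem_upper.2 (.inl rfl)
      · exact absurd (out' _ hx0) (by omega)
      · exact mem_upper.2 (.inr (.inr rfl))
  by_cases hj' : i = j + 1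
  · subst hj'
    have out' := fun q => out j q hij hj
    obtain ⟨h, ht⟩ := ht
    -- The shared axis is the first one of the sector, which calls for a `lower` triangle. At level
    -- 0 there is none, and `upper` with its apex takes its place.
    rcases Nat.eq_zero_or_pos h with rfl | hh
    · refine ⟨upper (j + 1) 0, ⟨0, .inl rfl⟩, ?_⟩
      rcases ht with rfl | ⟨hh, rfl⟩
      · intro x hx hx0
        rcases mem_upper.1 hx with rfl | rfl | rfl
        · rw [ray_zero]
          exact zero_mem_upper_zero _
        · exact absurd (out' _ hx0) (by omega)
        · exact mem_upper.2 (.inr (.inl rfl))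
      · omega
    · refine ⟨lower (j + 1) h, ⟨h, .inr ⟨hh, rfl⟩⟩, ?_⟩
      rcases ht with rfl | ⟨-, rfl⟩
      · intro x hx hx0
        rcases mem_upper.1 hx with rfl | rfl | rfl
        · exact mem_lower.2 (.inl rfl)
        · exact absurd (out' _ hx0) (by omega)
        · exact mem_lower.2 (.inr (.inr rfl))
      · intro x hx hx0
        rcases mem_lower.1 hx with rfl | rfl | rfl
        · exact absurd (out' _ hx0) (by omega)
        · exact mem_lower.2 (.inl rfl)
        · exact absurd (out' _ hx0) (by omega)
  · refine ⟨upper i 0, ⟨0, .inl rfl⟩, fun x hx hx0 => ?_⟩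
    obtain ⟨k, q, hk, rfl⟩ := ht.exists_eq_ray hx
    have : q = 0 := by
      refine out k q ?_ ?_ hx0
      · rcases hk with rfl | rfl
        exacts [hij, Ne.symm hj']
      · rcases hk with rfl | rfl
        · exact hj
        · exact fun e => hij (add_right_cancel e)
    subst this
    rw [ray_zero]
    exact zero_mem_upper_zero _

/-- `outsideForm i` vanishes on sector `i` and is nonnegative on every sector. A common point
therefore lies in the face of `s'` where the form vanishes; this face belongs to a triangle of
sector `i`, which reduces the claim to a single sector. -/
theorem inter_subset (hn : 3 ≤ n) {i j : Fin n}
    {s s' t t' : Finset (EuclideanSpace ℝ (Fin n))} (ht : IsTriangle i t) (ht' : IsTriangle j t')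
    (hs : s ⊆ t) (hs' : s' ⊆ t') :
    convexHull ℝ (s : Set _) ∩ convexHull ℝ (s' : Set _) ⊆
      convexHull ℝ (s ∩ s' : Set (EuclideanSpace ℝ (Fin n))) := by
  classical
  by_cases hij : j = i
  · subst hij
    exact inter_subset_same_sector hn ht ht' hs hs'
  rintro x ⟨hx, hx'⟩
  obtain ⟨t'', ht'', hsub⟩ := ht'.exists_of_other_sector hn hij
  have h0 : ∀ y ∈ s, outsideForm i y = 0 := by
    intro y hy
    obtain ⟨k, q, hk, rfl⟩ := ht.exists_eq_ray (hs hy)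
    rw [outsideForm_ray hn, if_pos hk]
  have h0' : ∀ y ∈ s', 0 ≤ outsideForm i y := by
    intro y hy
    obtain ⟨k, q, -, rfl⟩ := ht'.exists_eq_ray (hs' hy)
    rw [outsideForm_ray hn]
    split_ifs <;> positivity
  have hx0 : outsideForm i x = 0 :=
    le_antisymm (le_of_mem_convexHull _ (fun y hy => (h0 y hy).le) hx)
      (ge_of_mem_convexHull _ h0' hx')
  have hx1 := mem_convexHull_inter_hyperplane (-outsideForm i) (c := 0)
    (fun y hy => by simpa using h0' y hy) hx' (by simpa using hx0)
  have heq : (s' : Set (EuclideanSpace ℝ (Fin n))) ∩ {y | (-outsideForm i) y = 0} =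
      ((s'.filter fun y => outsideForm i y = 0 : Finset _) : Set _) := by
    ext; simp
  rw [heq] at hx1
  have := inter_subset_same_sector hn ht ht'' hs
    (s' := s'.filter fun y => outsideForm i y = 0)
    (fun y hy => hsub y (hs' (Finset.mem_filter.1 hy).1) (Finset.mem_filter.1 hy).2) ⟨hx, hx1⟩
  refine convexHull_mono ?_ this
  intro y hy
  exact ⟨hy.1, (Finset.mem_filter.1 hy.2).1⟩

end ConeStrip

/-! ### The complex and its underlying space -/

theorem smul_add_smul_add_smul_mem_convexHull {E : Type*} [AddCommGroup E] [Module ℝ E] {t : Set E}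
    {p q r : E} (hp : p ∈ t) (hq : q ∈ t) (hr : r ∈ t) {a b c : ℝ} (ha : 0 ≤ a) (hb : 0 ≤ b)
    (hc : 0 ≤ c) (h : a + b + c = 1) : a • p + b • q + c • r ∈ convexHull ℝ t := by
  have := (convex_convexHull ℝ t).sum_mem (t := Finset.univ) (w := ![a, b, c]) (z := ![p, q, r])
    (by intro k _; fin_cases k <;> assumption) (by simpa [Fin.sum_univ_three] using h)
    (by intro k _; fin_cases k <;> exact subset_convexHull ℝ t (by assumption))
  simpa [Fin.sum_univ_three] using this

namespace ConeStrip

variable {n : ℕ}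

/-- A coordinate as a linear functional. -/
noncomputable def coord (c : Fin n) : EuclideanSpace ℝ (Fin n) →ₗ[ℝ] ℝ :=
  ((EuclideanSpace.proj c : EuclideanSpace ℝ (Fin n) →L[ℝ] ℝ) :
    EuclideanSpace ℝ (Fin n) →ₗ[ℝ] ℝ)

theorem coord_apply (c : Fin n) (x : EuclideanSpace ℝ (Fin n)) : coord c x = x c := rfl

/-- The sum of the coordinates as a linear functional. -/
noncomputable def height : EuclideanSpace ℝ (Fin n) →ₗ[ℝ] ℝ := ∑ c, coord c

theorem height_apply (x : EuclideanSpace ℝ (Fin n)) : height x = ∑ c, x c := by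
  simp [height, coord_apply]

variable [NeZero n]

/-- The cone over the cycle formed by the segments between consecutive points at height `m`. -/
def cone (n : ℕ) [NeZero n] (m : ℕ) : Set (EuclideanSpace ℝ (Fin n)) :=
  {x | (∀ c, 0 ≤ x c) ∧ ∑ c, x c ≤ m ∧ ∃ i, ∀ c, c ≠ i → c ≠ i + 1 → x c = 0}

/-- The triangulation of the cone by the triangles of all sectors up to height `m`. -/
def complex (hn : 3 ≤ n) (m : ℕ) : Geometry.SimplicialComplex ℝ (EuclideanSpace ℝ (Fin n)) where
  faces := {s | s.Nonempty ∧ ∃ i, ∃ h < m, s ⊆ upper i h ∨ 1 ≤ h ∧ s ⊆ lower i h}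
  isRelLowerSet_faces := by
    rintro s ⟨hs, i, h, hm, hst⟩
    refine ⟨hs, fun t hts ht => ⟨ht, i, h, hm, ?_⟩⟩
    exact hst.imp (fun h => subset_trans hts h) (fun h => ⟨h.1, subset_trans hts h.2⟩)
  indep := by
    rintro s ⟨-, i, h, -, hs | ⟨hh, hs⟩⟩
    · exact (affineIndependent_upper hn i h).mono (Finset.coe_subset.2 hs)
    · exact (affineIndependent_lower hn i hh).mono (Finset.coe_subset.2 hs)
  inter_subset_convexHull := by
    have key : ∀ {s : Finset (EuclideanSpace ℝ (Fin n))}, (s.Nonempty ∧ ∃ i, ∃ h < m,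
        s ⊆ upper i h ∨ 1 ≤ h ∧ s ⊆ lower i h) → ∃ i t, IsTriangle i t ∧ s ⊆ t := by
      rintro s ⟨-, i, h, -, hs | ⟨hh, hs⟩⟩
      · exact ⟨i, _, ⟨h, .inl rfl⟩, hs⟩
      · exact ⟨i, _, ⟨h, .inr ⟨hh, rfl⟩⟩, hs⟩
    intro s s' hs hs'
    obtain ⟨i, t, ht, hst⟩ := key hs
    obtain ⟨j, t', ht', hst'⟩ := key hs'
    exact inter_subset hn ht ht' hst hst'

theorem finite_faces_complex (hn : 3 ≤ n) (m : ℕ) : (complex hn m).faces.Finite := by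
  classical
  have : (⋃ i : Fin n, ⋃ h ∈ Set.Iio m,
      (((upper i h).powerset ∪ (lower i h).powerset : Finset (Finset (EuclideanSpace ℝ (Fin n)))) :
        Set (Finset (EuclideanSpace ℝ (Fin n))))).Finite :=
    Set.finite_iUnion fun i => (Set.finite_Iio m).biUnion fun h _ =>
      Finset.finite_toSet _
  refine this.subset ?_
  rintro s ⟨-, i, h, hm, hs⟩
  simp only [Set.mem_iUnion]
  refine ⟨i, h, hm, ?_⟩
  rw [Finset.mem_coe, Finset.mem_union, Finset.mem_powerset, Finset.mem_powerset]
  exact hs.imp id And.right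

theorem exists_triangle_complex (hn : 3 ≤ n) (m : ℕ) (s) (hs : s ∈ (complex hn m).faces) :
    ∃ t ∈ (complex hn m).faces, s ⊆ t ∧ t.card = 3 := by
  obtain ⟨-, i, h, hm, hs | ⟨hh, hs⟩⟩ := hs
  · have hc := card_upper hn i h
    exact ⟨_, ⟨Finset.card_pos.1 (by omega), i, h, hm, .inl subset_rfl⟩, hs, hc⟩
  · have hc := card_lower hn i hh
    exact ⟨_, ⟨Finset.card_pos.1 (by omega), i, h, hm, .inr ⟨hh, subset_rfl⟩⟩, hs, hc⟩

/-- Later arguments need only this: a face stays in one sector and one layer, whichever triangle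
contains it. -/
theorem exists_level_of_mem_faces {hn : 3 ≤ n} {m : ℕ} {s : Finset (EuclideanSpace ℝ (Fin n))}
    (hs : s ∈ (complex hn m).faces) :
    ∃ i, ∃ h < m, ∀ x ∈ s, ∃ k q, (k = i ∨ k = i + 1) ∧ (q = h ∨ q = h + 1) ∧ x = ray k q := by
  obtain ⟨-, i, h, hm, hs⟩ := hs
  refine ⟨i, h, hm, fun x hx => ?_⟩
  rcases hs with hs | ⟨-, hs⟩
  · rcases mem_upper.1 (hs hx) with rfl | rfl | rfl
    exacts [⟨_, _, .inr rfl, .inl rfl, rfl⟩, ⟨_, _, .inl rfl, .inr rfl, rfl⟩,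
      ⟨_, _, .inr rfl, .inr rfl, rfl⟩]
  · rcases mem_lower.1 (hs hx) with rfl | rfl | rfl
    exacts [⟨_, _, .inl rfl, .inl rfl, rfl⟩, ⟨_, _, .inr rfl, .inl rfl, rfl⟩,
      ⟨_, _, .inl rfl, .inr rfl, rfl⟩]

theorem space_complex_subset_cone (hn : 3 ≤ n) (m : ℕ) : (complex hn m).space ⊆ cone n m := by
  intro x hx
  obtain ⟨s, hs, hx⟩ := Geometry.SimplicialComplex.mem_space_iff.1 hx
  obtain ⟨i, h, hm, hv⟩ := exists_level_of_mem_faces hs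
  refine ⟨fun c => ?_, ?_, i, fun c hc hc' => ?_⟩
  · refine ge_of_mem_convexHull (coord c) (fun y hy => ?_) hx
    obtain ⟨k, q, -, -, rfl⟩ := hv y hy
    rw [coord_apply, ray_apply]
    split_ifs <;> positivity
  · rw [← height_apply]
    refine le_of_mem_convexHull height (fun y hy => ?_) hx
    obtain ⟨k, q, -, hq, rfl⟩ := hv y hy
    rw [height_apply, sum_ray, Nat.cast_le]
    omega
  · have key : ∀ y ∈ (s : Set (EuclideanSpace ℝ (Fin n))), coord c y = 0 := by
      intro y hy
      obtain ⟨k, q, hk, -, rfl⟩ := hv y hy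
      rw [coord_apply, ray_apply, if_neg]
      rintro rfl
      tauto
    exact le_antisymm (le_of_mem_convexHull (coord c) (fun y hy => (key y hy).le) hx)
      (ge_of_mem_convexHull (coord c) (fun y hy => (key y hy).ge) hx)

theorem exists_nat_le_le_add_one {m : ℕ} (hm : 1 ≤ m) {r : ℝ} (h0 : 0 ≤ r) (h1 : r ≤ m) :
    ∃ h < m, (h : ℝ) ≤ r ∧ r ≤ h + 1 := by
  rcases h1.lt_or_eq with hlt | rfl
  · exact ⟨⌊r⌋₊, (Nat.floor_lt h0).2 hlt, Nat.floor_le h0, (Nat.lt_floor_add_one r).le⟩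
  -- At `r = m` the floor would be the excluded level `m`; the layer below contains its upper end.
  · refine ⟨m - 1, by omega, ?_, ?_⟩ <;> rw [Nat.cast_sub hm] <;> simp

theorem cone_subset_space_complex (hn : 3 ≤ n) {m : ℕ} (hm : 1 ≤ m) :
    cone n m ⊆ (complex hn m).space := by
  rintro x ⟨h0, hsum, i, hi⟩
  have h1 := add_one_ne hn i
  have hr : ∑ c, x c = x i + x (i + 1) :=
    Fintype.sum_eq_add i (i + 1) h1.symm fun c hc => hi c hc.1 hc.2
  rw [hr] at hsum
  obtain ⟨h, hhm, hle, hge⟩ :=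
    exists_nat_le_le_add_one hm (add_nonneg (h0 i) (h0 (i + 1))) hsum
  have hface : ∀ t, t.card = 3 → (t = upper i h ∨ 1 ≤ h ∧ t = lower i h) →
      x ∈ convexHull ℝ (t : Set (EuclideanSpace ℝ (Fin n))) → x ∈ (complex hn m).space := by
    intro t hc ht hx
    refine Geometry.SimplicialComplex.mem_space_iff.2
      ⟨t, ⟨Finset.card_pos.1 (by omega), i, h, hhm, ?_⟩, hx⟩
    exact ht.imp (fun e => e.subset) (fun e => ⟨e.1, e.2.subset⟩)
  have hx : ∀ y : EuclideanSpace ℝ (Fin n), y i = x i → y (i + 1) = x (i + 1) →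
      (∀ c, c ≠ i → c ≠ i + 1 → y c = 0) → y = x := by
    intro y h2 h3 h4
    ext c
    by_cases hc : c = i
    · rw [hc, h2]
    by_cases hc' : c = i + 1
    · rw [hc', h3]
    rw [h4 c hc hc', hi c hc hc']
  have ha := h0 i
  have hb := h0 (i + 1)
  set a := x i
  set b := x (i + 1)
  have hpos : (0 : ℝ) < h + 1 := by positivity
  -- The inequality is `h * a + (h + 1) * b ≤ h * (h + 1)`: the point lies on the apex side of the
  -- diagonal. The weights below are its barycentric coordinates, with `a + b - h` the total weight
  -- at height `h + 1`.
  by_cases hcase : 1 ≤ h ∧ (h + 1) * (a + b - h) ≤ a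
  · obtain ⟨hh, hcase⟩ := hcase
    have hpos' : (0 : ℝ) < h := by exact_mod_cast hh
    refine hface _ (card_lower hn i hh) (.inr ⟨hh, rfl⟩) ?_
    have := smul_add_smul_add_smul_mem_convexHull
      (t := (lower i h : Set (EuclideanSpace ℝ (Fin n)))) (mem_lower.2 (.inl rfl))
      (mem_lower.2 (.inr (.inl rfl))) (mem_lower.2 (.inr (.inr rfl)))
      (a := (a - (h + 1) * (a + b - h)) / h) (b := b / h) (c := a + b - h)
      (div_nonneg (by linarith) hpos'.le) (div_nonneg hb hpos'.le) (by linarith)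
      (by field_simp; ring)
    convert this
    refine (hx _ ?_ ?_ ?_).symm
    · simp [ray_apply, h1.symm]
      field_simp
      ring
    · simp [ray_apply, h1]
      field_simp
    · intro c hc hc'
      simp [ray_apply, hc, hc']
  · have hcase' : a ≤ (h + 1) * (a + b - h) := by
      by_cases hh : 1 ≤ h
      · exact (not_le.1 fun e => hcase ⟨hh, e⟩).le
      · obtain rfl : h = 0 := by omega
        simpa using hb
    refine hface _ (card_upper hn i h) (.inl rfl) ?_
    have := smul_add_smul_add_smul_mem_convexHull
      (t := (upper i h : Set (EuclideanSpace ℝ (Fin n)))) (mem_upper.2 (.inl rfl))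
      (mem_upper.2 (.inr (.inl rfl))) (mem_upper.2 (.inr (.inr rfl)))
      (a := 1 - (a + b - h)) (b := a / (h + 1)) (c := (a + b - h) - a / (h + 1))
      (by linarith) (div_nonneg ha hpos.le)
      (by rw [sub_nonneg, div_le_iff₀ hpos]; linarith)
      (by ring)
    convert this
    refine (hx _ ?_ ?_ ?_).symm
    · simp [ray_apply, h1.symm]
      field_simp
    · simp [ray_apply, h1]
      field_simp
      ring
    · intro c hc hc'
      simp [ray_apply, hc, hc']

theorem space_complex (hn : 3 ≤ n) {m : ℕ} (hm : 1 ≤ m) : (complex hn m).space = cone n m :=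
  (space_complex_subset_cone hn m).antisymm (cone_subset_space_complex hn hm)

end ConeStrip

/-! ### Angles and the parametrization of the cone by the disk -/

theorem Real.Angle.norm_coe_of_abs_le_pi {x : ℝ} (hx : |x| ≤ Real.pi) :
    ‖(x : Real.Angle)‖ = |x| := by
  refine (AddCircle.norm_coe_eq_abs_iff (2 * Real.pi) Real.two_pi_pos.ne').2 ?_
  rw [abs_of_pos Real.two_pi_pos]
  linarith

/-- The norm is the distance to a nearest multiple of `2π`. Multiples up to `0` are at least `x`
away, those from `2π` on at least `2π - x`. -/
theorem Real.Angle.le_norm_coe {x u : ℝ} (h1 : u ≤ x) (h2 : x ≤ 2 * Real.pi - u) :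
    u ≤ ‖(x : Real.Angle)‖ := by
  have : ‖(x : Real.Angle)‖ = _ := AddCircle.norm_eq (2 * Real.pi) (x := x)
  rw [this]
  generalize round ((2 * Real.pi)⁻¹ * x) = N
  have hpi := Real.two_pi_pos
  rcases le_or_gt N 0 with hN | hN
  · have hN' : (N : ℝ) ≤ 0 := by exact_mod_cast hN
    exact le_trans (by nlinarith) (le_abs_self _)
  · have hN' : (1 : ℝ) ≤ N := by exact_mod_cast hN
    exact le_trans (by nlinarith) (neg_le_abs _)

namespace ConeStrip

variable {n : ℕ}

/-- The angle of one sector. -/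
noncomputable def sectorAngle (n : ℕ) : ℝ := 2 * Real.pi / n

/-- The direction in which the `c`-th coordinate axis is drawn. -/
noncomputable def direction (c : Fin n) : Real.Angle := ((c.val * sectorAngle n : ℝ) : Real.Angle)

/-- The piecewise linear function of the angle that is `1` in the `c`-th direction and `0` in all
other directions. -/
noncomputable def hat (c : Fin n) (θ : Real.Angle) : ℝ :=
  max 0 (1 - ‖θ - direction c‖ / sectorAngle n)

theorem continuous_hat (c : Fin n) : Continuous (hat c) := by
  unfold hat
  fun_prop

theorem hat_nonneg (c : Fin n) (θ : Real.Angle) : 0 ≤ hat c θ := le_max_left _ _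

variable [NeZero n]

theorem natCast_mul_sectorAngle : (n : ℝ) * sectorAngle n = 2 * Real.pi := by
  have : (n : ℝ) ≠ 0 := Nat.cast_ne_zero.2 (NeZero.ne n)
  rw [sectorAngle]
  field_simp

theorem sectorAngle_pos : 0 < sectorAngle n := by
  have : (0 : ℝ) < n := Nat.cast_pos.2 (Nat.pos_of_ne_zero (NeZero.ne n))
  exact div_pos Real.two_pi_pos this

theorem sectorAngle_le_pi (hn : 3 ≤ n) : sectorAngle n ≤ Real.pi := by
  have h : (3 : ℝ) ≤ n := by exact_mod_cast hn
  have := natCast_mul_sectorAngle (n := n)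
  nlinarith [sectorAngle_pos (n := n)]

/-- Shifting the index by `n` is a full turn; this makes `direction` additive on `Fin n`. -/
theorem coe_mod_mul_sectorAngle (k : ℤ) :
    ((((k % n : ℤ) : ℝ) * sectorAngle n : ℝ) : Real.Angle) =
      ((k * sectorAngle n : ℝ) : Real.Angle) := by
  rw [Real.Angle.angle_eq_iff_two_pi_dvd_sub]
  refine ⟨-(k / n), ?_⟩
  have h : ((k % n : ℤ) : ℝ) = k - n * (k / n : ℤ) := by
    rw [Int.emod_def]; push_cast; ring
  rw [h, ← natCast_mul_sectorAngle (n := n)]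
  push_cast
  ring

theorem direction_add (a b : Fin n) : direction (a + b) = direction a + direction b := by
  have := coe_mod_mul_sectorAngle (n := n) (a.val + b.val)
  simp only [direction, Fin.val_add, ← Real.Angle.coe_add, ← add_mul]
  exact_mod_cast this

theorem direction_sub (a b : Fin n) : direction (a - b) = direction a - direction b := by
  rw [eq_sub_iff_add_eq, ← direction_add, sub_add_cancel]

theorem direction_one (hn : 3 ≤ n) : direction (1 : Fin n) = (sectorAngle n : Real.Angle) := by
  rw [direction, Fin.val_one', Nat.mod_eq_of_lt (by omega)]
  simp

theorem exists_eq_direction_add (θ : Real.Angle) :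
    ∃ (k : Fin n) (s : ℝ), 0 ≤ s ∧ s < 1 ∧ θ = direction k + ((s * sectorAngle n : ℝ) :) := by
  induction θ using Real.Angle.induction_on with | _ x
  have hn0 : (0 : ℤ) < n := by exact_mod_cast Nat.pos_of_ne_zero (NeZero.ne n)
  have hu := sectorAngle_pos (n := n)
  set y := x / sectorAngle n with hy
  have h0 := Int.emod_nonneg ⌊y⌋ hn0.ne'
  have h1 := Int.emod_lt_of_pos ⌊y⌋ hn0
  refine ⟨⟨(⌊y⌋ % n).toNat, by omega⟩, Int.fract y, Int.fract_nonneg y, Int.fract_lt_one y, ?_⟩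
  have hcast : (((⌊y⌋ % n).toNat : ℕ) : ℝ) = ((⌊y⌋ % n : ℤ) : ℝ) := by
    exact_mod_cast Int.toNat_of_nonneg h0
  rw [direction]
  simp only [hcast]
  rw [coe_mod_mul_sectorAngle, ← Real.Angle.coe_add, ← add_mul, Int.floor_add_fract, hy,
    div_mul_cancel₀ _ hu.ne']

theorem hat_le_one (c : Fin n) (θ : Real.Angle) : hat c θ ≤ 1 :=
  max_le zero_le_one (sub_le_self _ (div_nonneg (norm_nonneg _) sectorAngle_pos.le))

variable {k : Fin n} {s : ℝ}

theorem hat_left (hn : 3 ≤ n) (h0 : 0 ≤ s) (h1 : s ≤ 1) :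
    hat k (direction k + ((s * sectorAngle n : ℝ) :)) = 1 - s := by
  have hu := sectorAngle_pos (n := n)
  have habs : |s * sectorAngle n| = s * sectorAngle n := abs_of_nonneg (by positivity)
  rw [hat, add_sub_cancel_left, Real.Angle.norm_coe_of_abs_le_pi, habs,
    mul_div_cancel_right₀ _ hu.ne', max_eq_right (by linarith)]
  rw [habs]
  nlinarith [sectorAngle_le_pi hn]

theorem hat_right (hn : 3 ≤ n) (h0 : 0 ≤ s) (h1 : s ≤ 1) :
    hat (k + 1) (direction k + ((s * sectorAngle n : ℝ) :)) = s := by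
  have hu := sectorAngle_pos (n := n)
  have habs : |(s - 1) * sectorAngle n| = (1 - s) * sectorAngle n := by
    rw [abs_of_nonpos (by nlinarith)]
    ring
  have hang : direction k + ((s * sectorAngle n : ℝ) : Real.Angle) - direction (k + 1) =
      (((s - 1) * sectorAngle n : ℝ) :) := by
    rw [direction_add, direction_one hn, add_sub_add_left_eq_sub, ← Real.Angle.coe_sub]
    ring_nf
  rw [hat, hang, Real.Angle.norm_coe_of_abs_le_pi, habs,
    mul_div_cancel_right₀ _ hu.ne', max_eq_right (by linarith)]
  · ring
  rw [habs]
  nlinarith [sectorAngle_le_pi hn]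

theorem hat_other (hn : 3 ≤ n) (h0 : 0 ≤ s) (h1 : s ≤ 1) {c : Fin n} (hc : c ≠ k)
    (hc' : c ≠ k + 1) : hat c (direction k + ((s * sectorAngle n : ℝ) :)) = 0 := by
  have hu := sectorAngle_pos (n := n)
  have hnu := natCast_mul_sectorAngle (n := n)
  -- Excluding `c = k` and `c = k + 1` leaves `1 ≤ j ≤ n - 2`, so the angle `(j + s) * sectorAngle
  -- n` stays a full sector away from `0` and from `2π`.
  obtain ⟨j, hj⟩ : ∃ j, j = k - c := ⟨_, rfl⟩
  have hj0 : j.val ≠ 0 := by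
    intro e
    have e' : k - c = 0 := by
      rw [← hj]
      exact Fin.ext e
    exact hc (sub_eq_zero.1 e').symm
  have hj1 : j.val + 1 ≠ n := by
    intro e
    have : j + 1 = 0 := by
      apply Fin.ext
      rw [Fin.val_add, Fin.val_one', Nat.mod_eq_of_lt (a := 1) (by omega), e]
      simp
    rw [hj, sub_add_eq_add_sub, sub_eq_zero] at this
    exact hc' this.symm
  have hj2 := j.isLt
  have hlo : (1 : ℝ) ≤ j.val := by exact_mod_cast Nat.one_le_iff_ne_zero.2 hj0
  have hhi : (j.val : ℝ) + 2 ≤ n := by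
    have : j.val + 2 ≤ n := by omega
    exact_mod_cast this
  have hang : direction k + ((s * sectorAngle n : ℝ) : Real.Angle) - direction c =
      (((j.val + s) * sectorAngle n : ℝ) :) := by
    rw [add_sub_right_comm, ← direction_sub, ← hj, direction, ← Real.Angle.coe_add, ← add_mul]
  have := Real.Angle.le_norm_coe (x := (j.val + s) * sectorAngle n) (u := sectorAngle n)
    (by nlinarith) (by nlinarith)
  rw [hat, hang, max_eq_left]
  rw [sub_nonpos, le_div_iff₀ hu]
  linarith

theorem sum_hat (hn : 3 ≤ n) (θ : Real.Angle) : ∑ c : Fin n, hat c θ = 1 := by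
  obtain ⟨k, s, h0, h1, rfl⟩ := exists_eq_direction_add (n := n) θ
  rw [Fintype.sum_eq_add k (k + 1) (add_one_ne hn k).symm
    fun c hc => hat_other hn h0 h1.le hc.1 hc.2, hat_left hn h0 h1.le, hat_right hn h0 h1.le]
  ring

theorem eq_of_hat_eq (hn : 3 ≤ n) {θ θ' : Real.Angle} (h : ∀ c : Fin n, hat c θ = hat c θ') :
    θ = θ' := by
  obtain ⟨k, s, h0, h1, rfl⟩ := exists_eq_direction_add (n := n) θ
  obtain ⟨k', s', h0', h1', rfl⟩ := exists_eq_direction_add (n := n) θ'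
  have hk := h k
  have hk' := h k'
  rw [hat_left hn h0 h1.le] at hk
  rw [hat_left hn h0' h1'.le] at hk'
  -- As `s, s' < 1`, the hats at `k` and `k'` are positive, so each index is the other or its
  -- successor. Being successors of each other would force `1 + 1 = 0` in `Fin n`.
  have hkk : k = k' := by
    by_contra hne
    have e1 : k = k' + 1 := by
      by_contra hne'
      rw [hat_other hn h0' h1'.le hne hne'] at hk
      linarith
    have e2 : k' = k + 1 := by
      by_contra hne'
      rw [hat_other hn h0 h1.le (Ne.symm hne) hne'] at hk'
      linarith
    exact add_one_add_one_ne hn k (by rw [← e2, ← e1])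
  subst hkk
  rw [hat_left hn h0' h1'.le] at hk
  obtain rfl : s = s' := by linarith
  rfl

/-- The parametrization of the cone of height `m` by the complex unit disk. -/
noncomputable def diskMap (n : ℕ) [NeZero n] (m : ℕ) (z : ℂ) : EuclideanSpace ℝ (Fin n) :=
  WithLp.toLp 2 fun c => m * ‖z‖ * hat c (z.arg : Real.Angle)

theorem diskMap_apply (m : ℕ) (z : ℂ) (c : Fin n) :
    diskMap n m z c = m * ‖z‖ * hat c (z.arg : Real.Angle) := rfl

/-- The hats form a partition of unity, so the modulus becomes the height up to the factor `m`.
Injectivity and the description of the boundary rest on this. -/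
theorem sum_diskMap (hn : 3 ≤ n) (m : ℕ) (z : ℂ) : ∑ c, diskMap n m z c = m * ‖z‖ := by
  simp only [diskMap_apply, ← Finset.mul_sum, sum_hat hn, mul_one]

theorem continuous_diskMap (m : ℕ) : Continuous (diskMap n m) := by
  refine (PiLp.continuous_toLp 2 _).comp (continuous_pi fun c => ?_)
  rw [continuous_iff_continuousAt]
  intro z
  -- The argument is discontinuous at `0`, but there the bounded hat is multiplied by a factor
  -- tending to `0`. Elsewhere the argument is continuous as an angle, also across the negative real
  -- axis.
  by_cases hz : z = 0
  · subst hz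
    have h1 : Filter.Tendsto (fun z : ℂ => (m : ℝ) * ‖z‖) (nhds 0) (nhds 0) := by
      have : Continuous fun z : ℂ => (m : ℝ) * ‖z‖ := by fun_prop
      simpa using this.tendsto 0
    have h2 : Filter.Tendsto (fun z : ℂ => (m : ℝ) * ‖z‖ * hat c (z.arg : Real.Angle))
        (nhds 0) (nhds 0) := by
      refine squeeze_zero (fun z => ?_) (fun z => ?_) h1
      · exact mul_nonneg (by positivity) (hat_nonneg _ _)
      · exact mul_le_of_le_one_right (by positivity) (hat_le_one _ _)
    rw [ContinuousAt]
    convert h2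
    simp
  · refine ContinuousAt.mul (by fun_prop) ?_
    exact ((continuous_hat c).continuousAt).comp (Complex.continuousAt_arg_coe_angle hz)

theorem diskMap_mem_cone (hn : 3 ≤ n) (m : ℕ) {z : ℂ} (hz : ‖z‖ ≤ 1) :
    diskMap n m z ∈ cone n m := by
  refine ⟨fun c => mul_nonneg (by positivity) (hat_nonneg _ _), ?_, ?_⟩
  · rw [sum_diskMap hn]
    exact mul_le_of_le_one_right (by positivity) hz
  · obtain ⟨k, s, h0, h1, hθ⟩ := exists_eq_direction_add (n := n) (z.arg : Real.Angle)
    refine ⟨k, fun c hc hc' => ?_⟩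
    rw [diskMap_apply, hθ, hat_other hn h0 h1.le hc hc', mul_zero]

theorem injective_diskMap (hn : 3 ≤ n) {m : ℕ} (hm : 1 ≤ m) :
    Function.Injective (diskMap n m) := by
  intro z w h
  have hm0 : (m : ℝ) ≠ 0 := Nat.cast_ne_zero.2 (by omega)
  have hnorm : ‖z‖ = ‖w‖ := by
    have := congrArg (fun x : EuclideanSpace ℝ (Fin n) => ∑ c, x c) h
    simp only [sum_diskMap hn] at this
    exact mul_left_cancel₀ hm0 this
  by_cases hz : z = 0
  · subst hz
    rw [norm_zero] at hnorm
    exact (norm_eq_zero.1 hnorm.symm).symm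
  refine Complex.ext_norm_arg hnorm (Complex.arg_coe_angle_eq_iff.1 (eq_of_hat_eq hn fun c => ?_))
  have := congrArg (fun x : EuclideanSpace ℝ (Fin n) => x c) h
  simp only [diskMap_apply, ← hnorm] at this
  exact mul_left_cancel₀ (mul_ne_zero hm0 (norm_ne_zero_iff.2 hz)) this

theorem exists_diskMap_eq (hn : 3 ≤ n) {m : ℕ} (hm : 1 ≤ m) {x : EuclideanSpace ℝ (Fin n)}
    (hx : x ∈ cone n m) : ∃ z : ℂ, ‖z‖ ≤ 1 ∧ diskMap n m z = x := by
  obtain ⟨h0, hsum, i, hi⟩ := hx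
  have hm0 : (0 : ℝ) < m := Nat.cast_pos.2 hm
  have hr : ∑ c, x c = x i + x (i + 1) :=
    Fintype.sum_eq_add i (i + 1) (add_one_ne hn i).symm fun c hc => hi c hc.1 hc.2
  rw [hr] at hsum
  have ha := h0 i
  have hb := h0 (i + 1)
  -- The apex has no direction. Any other point has height `r` and position `s` in its sector, with
  -- `x i = r * (1 - s)` and `x (i + 1) = r * s`.
  rcases (add_nonneg ha hb).eq_or_lt with hzero | hpos
  · refine ⟨0, by simp, ?_⟩
    ext c
    have : x c = 0 := by
      by_cases hc : c = i
      · subst hc; linarith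
      by_cases hc' : c = i + 1
      · subst hc'; linarith
      exact hi c hc hc'
    simp [diskMap_apply, this]
  set r := x i + x (i + 1) with hr'
  set s := x (i + 1) / r with hs
  have hs0 : 0 ≤ s := div_nonneg hb hpos.le
  have hs1 : s ≤ 1 := by rw [hs, div_le_one hpos]; linarith
  have hsr : r * s = x (i + 1) := by rw [hs]; field_simp
  set t : ℝ := i.val * sectorAngle n + s * sectorAngle n with ht
  have hrm : 0 < r / m := div_pos hpos hm0
  have hnorm : ‖((r / m : ℝ) : ℂ) * (Real.cos t + Real.sin t * Complex.I)‖ = r / m := by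
    rw [norm_mul, Complex.norm_real, Complex.ofReal_cos, Complex.ofReal_sin,
      Complex.norm_cos_add_sin_mul_I, mul_one, Real.norm_of_nonneg hrm.le]
  have harg : (Complex.arg (((r / m : ℝ) : ℂ) * (Real.cos t + Real.sin t * Complex.I)) :
      Real.Angle) = direction i + ((s * sectorAngle n : ℝ) :) := by
    rw [← Real.Angle.cos_coe, ← Real.Angle.sin_coe,
      Complex.arg_mul_cos_add_sin_mul_I_coe_angle hrm, ht, Real.Angle.coe_add]
    rfl
  refine ⟨_, hnorm.trans_le ((div_le_one hm0).2 hsum), ?_⟩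
  ext c
  rw [diskMap_apply, harg, hnorm, mul_div_cancel₀ _ hm0.ne']
  by_cases hc : c = i
  · subst hc
    rw [hat_left hn hs0 hs1]
    linarith
  by_cases hc' : c = i + 1
  · subst hc'
    rw [hat_right hn hs0 hs1, hsr]
  rw [hat_other hn hs0 hs1 hc hc', hi c hc hc', mul_zero]

end ConeStrip

/-! ### The triangulated disk and its boundary cycle -/

theorem SimpleGraph.Connected.dist_lt_card {V : Type*} [Fintype V] {G : SimpleGraph V}
    (hG : G.Connected) (u v : V) : G.dist u v < Fintype.card V := by
  obtain ⟨p, hp, hd⟩ := hG.exists_path_of_dist u v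
  exact hd ▸ hp.length_lt

namespace ConeStrip

variable {n : ℕ} [NeZero n]

/-- The homeomorphism from the unit disk onto the cone of height `m`. -/
noncomputable def diskHomeo (hn : 3 ≤ n) {m : ℕ} (hm : 1 ≤ m) :
    Metric.closedBall (0 : EuclideanSpace ℝ (Fin 2)) 1 ≃ₜ (complex hn m).space :=
  have hmem : ∀ y : Metric.closedBall (0 : EuclideanSpace ℝ (Fin 2)) 1,
      diskMap n m (Complex.orthonormalBasisOneI.repr.symm y) ∈ (complex hn m).space := by
    intro y
    rw [space_complex hn hm]
    refine diskMap_mem_cone hn m ?_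
    rw [LinearIsometryEquiv.norm_map]
    exact mem_closedBall_zero_iff.1 y.2
  have hbij : Function.Bijective fun y : Metric.closedBall (0 : EuclideanSpace ℝ (Fin 2)) 1 =>
      (⟨_, hmem y⟩ : (complex hn m).space) := by
    constructor
    · intro y y' h
      exact Subtype.ext (Complex.orthonormalBasisOneI.repr.symm.injective
        (injective_diskMap hn hm (congrArg Subtype.val h)))
    · rintro ⟨x, hx⟩
      obtain ⟨z, hz, rfl⟩ := exists_diskMap_eq hn hm (space_complex_subset_cone hn m hx)
      refine ⟨⟨Complex.orthonormalBasisOneI.repr z, ?_⟩, ?_⟩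
      · rwa [mem_closedBall_zero_iff, LinearIsometryEquiv.norm_map]
      · simp only [LinearIsometryEquiv.symm_apply_apply]
  Continuous.homeoOfEquivCompactToT2 (f := Equiv.ofBijective _ hbij)
    (((continuous_diskMap m).comp (Complex.orthonormalBasisOneI.repr.symm.continuous.comp
      continuous_subtype_val)).subtype_mk hmem)

theorem sum_diskHomeo (hn : 3 ≤ n) {m : ℕ} (hm : 1 ≤ m)
    (y : Metric.closedBall (0 : EuclideanSpace ℝ (Fin 2)) 1) :
    ∑ c, (diskHomeo hn hm y : EuclideanSpace ℝ (Fin n)) c = m * ‖y.1‖ := by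
  rw [← LinearIsometryEquiv.norm_map Complex.orthonormalBasisOneI.repr.symm y.1]
  exact sum_diskMap hn m _

/-- The triangulated disk of radius `m` with `n` sectors. -/
noncomputable def triangulation (hn : 3 ≤ n) {m : ℕ} (hm : 1 ≤ m) : DiskTriangulation n where
  complex := complex hn m
  finite_faces := finite_faces_complex hn m
  triangular := exists_triangle_complex hn m
  homeo := (diskHomeo hn hm).symm

variable (hn : 3 ≤ n) {m : ℕ} (hm : 1 ≤ m)

/-- The norm of the corresponding disk point is the height divided by `m`, so the unit circle
corresponds to the points of height `m`. -/
theorem mem_boundary {x : EuclideanSpace ℝ (Fin n)} :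
    x ∈ (triangulation hn hm).boundary ↔ x ∈ (complex hn m).space ∧ ∑ c, x c = m := by
  have hm0 : (m : ℝ) ≠ 0 := Nat.cast_ne_zero.2 (by omega)
  rw [← exists_prop]
  refine exists_congr fun hx => ?_
  have := sum_diskHomeo hn hm ((diskHomeo hn hm).symm ⟨x, hx⟩)
  rw [Homeomorph.apply_symm_apply] at this
  rw [this, mul_eq_left₀ hm0, ← mem_sphere_zero_iff_norm]
  rfl

theorem outer_edge_mem_faces (hm : 1 ≤ m) (i : Fin n) {s : Finset (EuclideanSpace ℝ (Fin n))}
    (hs : s.Nonempty) (h : ∀ x ∈ s, x = ray i m ∨ x = ray (i + 1) m) :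
    s ∈ (complex hn m).faces := by
  -- The outer edge of a sector belongs to the `upper` triangle of the last layer, whose level is `m
  -- - 1`.
  refine ⟨hs, i, m - 1, by omega, .inl fun x hx => mem_upper.2 ?_⟩
  rw [Nat.sub_add_cancel hm]
  exact .inr (h x hx)

theorem ray_mem_vertices (hm : 1 ≤ m) (i : Fin n) : ray i m ∈ (complex hn m).vertices :=
  outer_edge_mem_faces hn hm i (Finset.singleton_nonempty _)
    fun _ hx => .inl (Finset.mem_singleton.1 hx)

theorem exists_eq_ray_of_mem_vertices {x : EuclideanSpace ℝ (Fin n)}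
    (hx : x ∈ (complex hn m).vertices) : ∃ k q, x = ray k q := by
  obtain ⟨i, h, -, hv⟩ := exists_level_of_mem_faces (hn := hn) hx
  obtain ⟨k, q, -, -, e⟩ := hv x (Finset.mem_singleton_self x)
  exact ⟨k, q, e⟩

/-- The vertex of the boundary on the `i`-th coordinate axis. -/
noncomputable def outer (i : Fin n) : (triangulation hn hm).BoundaryVertex :=
  ⟨⟨ray i m, ray_mem_vertices hn hm i⟩, (mem_boundary hn hm).2
    ⟨Geometry.SimplicialComplex.vertices_subset_space (ray_mem_vertices hn hm i), sum_ray i m⟩⟩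

theorem outer_bijective : Function.Bijective (outer hn hm) := by
  constructor
  · intro i j h
    exact (ray_injective hm (congrArg (fun v => v.1.1) h)).1
  · rintro ⟨⟨x, hx⟩, hb⟩
    obtain ⟨k, q, rfl⟩ := exists_eq_ray_of_mem_vertices hn hx
    have := ((mem_boundary hn hm).1 hb).2
    rw [sum_ray, Nat.cast_inj] at this
    subst this
    exact ⟨k, rfl⟩

theorem boundaryGraph_adj_outer {i j : Fin n} :
    (triangulation hn hm).boundaryGraph.Adj (outer hn hm i) (outer hn hm j) ↔
      i = j + 1 ∨ j = i + 1 := by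
  classical
  constructor
  · rintro ⟨⟨hne, hface⟩, -⟩
    have hij : i ≠ j := fun e => hne (by rw [e])
    obtain ⟨k, h, -, hv⟩ := exists_level_of_mem_faces (hn := hn) hface
    obtain ⟨a, p, ha, -, e⟩ := hv (ray i m) (Finset.mem_insert_self _ _)
    obtain ⟨b, q, hb, -, e'⟩ :=
      hv (ray j m) (Finset.mem_insert_of_mem (Finset.mem_singleton_self _))
    obtain ⟨rfl, -⟩ := ray_injective hm e
    obtain ⟨rfl, -⟩ := ray_injective hm e'
    rcases ha with rfl | rfl <;> rcases hb with rfl | rfl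
    · exact absurd rfl hij
    · exact .inr rfl
    · exact .inl rfl
    · exact absurd rfl hij
  · intro h
    have hij : i ≠ j := by
      rcases h with rfl | rfl
      exacts [add_one_ne hn _, (add_one_ne hn _).symm]
    have hface : ({ray i m, ray j m} : Finset (EuclideanSpace ℝ (Fin n))) ∈
        (complex hn m).faces := by
      rcases h with rfl | rfl
      · exact outer_edge_mem_faces hn hm j (Finset.insert_nonempty _ _) fun x hx => by
          simpa [or_comm] using hx
      · exact outer_edge_mem_faces hn hm i (Finset.insert_nonempty _ _) fun x hx => by
          simpa using hx
    refine ⟨⟨fun e => hij (ray_injective hm (congrArg Subtype.val e)).1, ?_⟩, fun x hx => ?_⟩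
    · convert hface <;> rfl
    have hx' : x ∈ convexHull ℝ
        (({ray i m, ray j m} : Finset (EuclideanSpace ℝ (Fin n))) : Set _) := by
      rw [Finset.coe_pair, convexHull_pair]
      exact hx
    -- The height is linear and equals `m` at both ends, hence along the whole edge.
    refine (mem_boundary hn hm).2
      ⟨Geometry.SimplicialComplex.convexHull_subset_space hface hx', ?_⟩
    have hv : ∀ y ∈ ({ray i m, ray j m} : Finset (EuclideanSpace ℝ (Fin n))),
        height y = m := by
      intro y hy
      rcases Finset.mem_insert.1 hy with rfl | hy
      · rw [height_apply, sum_ray]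
      · rw [Finset.mem_singleton.1 hy, height_apply, sum_ray]
    rw [← height_apply]
    exact le_antisymm (le_of_mem_convexHull _ (fun y hy => (hv y hy).le) hx')
      (ge_of_mem_convexHull _ (fun y hy => (hv y hy).ge) hx')

theorem cycleGraph_adj_iff (hn : 3 ≤ n) {i j : Fin n} :
    (SimpleGraph.cycleGraph n).Adj i j ↔ i = j + 1 ∨ j = i + 1 := by
  have hone : ∀ a : Fin n, a.val = 1 ↔ a = 1 := by
    intro a
    rw [Fin.ext_iff, Fin.val_one', Nat.mod_eq_of_lt (by omega)]
  rw [SimpleGraph.cycleGraph_adj', hone, hone, sub_eq_iff_eq_add', sub_eq_iff_eq_add']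

/-- The boundary of the triangulated disk is a cycle. -/
noncomputable def boundaryIso :
    SimpleGraph.cycleGraph n ≃g (triangulation hn hm).boundaryGraph where
  toEquiv := Equiv.ofBijective _ (outer_bijective hn hm)
  map_rel_iff' := (boundaryGraph_adj_outer hn hm).trans (cycleGraph_adj_iff hn).symm

/-! ### Distances in the 1-skeleton -/

theorem boundaryGraph_connected : (triangulation hn hm).boundaryGraph.Connected := by
  rw [← (boundaryIso hn hm).connected_iff]
  obtain ⟨k, rfl⟩ : ∃ k, n = k + 1 := ⟨n - 1, by omega⟩
  exact SimpleGraph.cycleGraph_connected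

/-- This crude bound is enough: for `n ≤ m` the truncation at height `m` in `potential` has no
effect on the boundary. -/
theorem dist_outer_lt (i : Fin n) (v : (triangulation hn hm).BoundaryVertex) :
    (triangulation hn hm).boundaryGraph.dist (outer hn hm i) v < n := by
  let := Fintype.ofEquiv _ (Equiv.ofBijective _ (outer_bijective hn hm))
  have hc := Fintype.card_congr (Equiv.ofBijective _ (outer_bijective hn hm))
  rw [Fintype.card_fin] at hc
  exact ((boundaryGraph_connected hn hm).dist_lt_card _ _).trans_eq hc.symm

/-- The function that takes the value `min q d` at height `q` on an axis whose boundary vertex has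
distance `d` from `v`. -/
noncomputable def potential (v : (triangulation hn hm).BoundaryVertex)
    (x : EuclideanSpace ℝ (Fin n)) : ℝ :=
  ∑ c, min (x c) ((triangulation hn hm).boundaryGraph.dist (outer hn hm c) v)

theorem potential_ray (v : (triangulation hn hm).BoundaryVertex) (i : Fin n) (q : ℕ) :
    potential hn hm v (ray i q) =
      min (q : ℝ) ((triangulation hn hm).boundaryGraph.dist (outer hn hm i) v) := by
  rw [potential, Fintype.sum_eq_single i, ray_apply, if_pos rfl]
  intro c hc
  rw [ray_apply, if_neg hc]
  exact min_eq_left (Nat.cast_nonneg _)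

theorem dist_outer_le (v : (triangulation hn hm).BoundaryVertex) {i j k : Fin n}
    (hi : i = k ∨ i = k + 1) (hj : j = k ∨ j = k + 1) :
    (triangulation hn hm).boundaryGraph.dist (outer hn hm i) v ≤
      (triangulation hn hm).boundaryGraph.dist (outer hn hm j) v + 1 := by
  by_cases hij : i = j
  · subst hij
    omega
  have hadj : (triangulation hn hm).boundaryGraph.Adj (outer hn hm i) (outer hn hm j) := by
    rw [boundaryGraph_adj_outer]
    rcases hi with rfl | rfl <;> rcases hj with rfl | rfl <;> simp_all
  have := (boundaryGraph_connected hn hm).dist_triangle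
    (u := outer hn hm i) (v := outer hn hm j) (w := v)
  rw [SimpleGraph.dist_eq_one_iff_adj.2 hadj] at this
  omega

/-- The ends of an edge share a sector and a layer, so their heights differ by at most 1, and so do
the distances from the ends of their axes to `v`; the minimum inherits the bound. -/
theorem potential_le_of_adj (v : (triangulation hn hm).BoundaryVertex)
    {x y : (triangulation hn hm).complex.vertices} (h : (triangulation hn hm).oneSkeleton.Adj x y) :
    potential hn hm v x ≤ potential hn hm v y + 1 := by
  classical
  obtain ⟨k, l, -, hv⟩ := exists_level_of_mem_faces (hn := hn) h.2
  obtain ⟨i, p, hi, hp, hx⟩ := hv x (by simp)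
  obtain ⟨j, q, hj, hq, hy⟩ := hv y (by simp)
  rw [hx, hy, potential_ray, potential_ray]
  have h1 : (p : ℝ) ≤ q + 1 := by
    have : p ≤ q + 1 := by omega
    exact_mod_cast this
  have h2 : ((triangulation hn hm).boundaryGraph.dist (outer hn hm i) v : ℝ) ≤
      (triangulation hn hm).boundaryGraph.dist (outer hn hm j) v + 1 := by
    exact_mod_cast dist_outer_le hn hm v hi hj
  rw [← min_add_add_right]
  exact min_le_min h1 h2

theorem potential_le_of_walk (v : (triangulation hn hm).BoundaryVertex)
    {x y : (triangulation hn hm).complex.vertices} (p : (triangulation hn hm).oneSkeleton.Walk x y) :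
    potential hn hm v x ≤ potential hn hm v y + p.length := by
  induction p with
  | nil => simp
  | cons h p ih =>
    have := potential_le_of_adj hn hm v h
    rw [SimpleGraph.Walk.length_cons]
    push_cast
    linarith

/-- The potential for `v` is `0` at `v` and, since `n ≤ m`, equals the boundary distance at `u`; a
walk lowers it by at most 1 per edge. -/
theorem isIsometricFilling_triangulation (hnm : n ≤ m) :
    (triangulation hn hm).IsIsometricFilling n where
  boundary_cycle := ⟨(boundaryIso hn hm).symm⟩
  isometric u v p := by
    obtain ⟨i, rfl⟩ := (outer_bijective hn hm).2 u
    obtain ⟨j, rfl⟩ := (outer_bijective hn hm).2 v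
    have h := potential_le_of_walk hn hm (outer hn hm j) p
    have hlt := dist_outer_lt hn hm i (outer hn hm j)
    have hle : ((triangulation hn hm).boundaryGraph.dist (outer hn hm i) (outer hn hm j) : ℝ) ≤
        m := by exact_mod_cast hlt.le.trans hnm
    have hi : potential hn hm (outer hn hm j) ((outer hn hm i).1 : EuclideanSpace ℝ (Fin n)) =
        _ := potential_ray hn hm _ i m
    have hj : potential hn hm (outer hn hm j) ((outer hn hm j).1 : EuclideanSpace ℝ (Fin n)) =
        _ := potential_ray hn hm _ j m
    rw [hi, hj, SimpleGraph.dist_self, min_eq_right hle, Nat.cast_zero,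
      min_eq_right (Nat.cast_nonneg m), zero_add] at h
    exact_mod_cast h

end ConeStrip

theorem mainTheorem3 (n : ℕ) (hn : 3 ≤ n) :
    ∃ (d : ℕ) (T : DiskTriangulation d), T.IsIsometricFilling n := by
  have : NeZero n := ⟨by omega⟩
  exact ⟨n, _, ConeStrip.isIsometricFilling_triangulation hn (m := n) (by omega) le_rfl⟩
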